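/- Let $BC\cap\mathrm{Lip}_0$ denote the bounded, Lipschitz continuous functions $\phi:[0,\infty)\to\mathbb R$ with $\phi(0)=0$. Consider the coagulation–fragmentation equation with kernels $a(s,\hat s)=s\hat s$ and $b(s,\hat s)=1$. A family $(\mu_t)_{t\ge0}$ of positive Radon measures on $(0,\infty)$ with finite mass $m_1(t)=\int_0^\infty s\,\mu_t(ds)<\infty$ for all $t\ge 0$ is a *weak solution in the measure sense* if for every $\phi\in BC\cap\mathrm{Lip}_0$ the function $t\mapsto\int_0^\infty\phi\,d\mu_t$ is continuous at $t=0$ (from the right) and, for all $t>0$, is differentiable with $$\frac{d}{dt}\int_0^\infty\phi(s)\,\mu_t(ds)=\frac12\int_0^\infty\!\!\int_0^\infty\big(\phi(s+\hat s)-\phi(s)-\phi(\hat s)\big)s\hat s\,\mu_t(d\hat s)\,\mu_t(ds)-\frac12\int_0^\infty\Big(\int_0^s\big(\phi(s)-\phi(\hat s)-\phi(s-\hat s)\big)d\hat s\Big)\mu_t(ds).$$ A *solution* is a function $c(s,t)\ge0$, $s>0$, $t\ge0$, measurable in $s$, such that $\mu_t(ds)=c(s,t)\,ds$ satisfies the same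 requirements; densities are identified when they agree for a.e. $s$. A solution of either kind is *mass-conserving* if $m_1(t)=m_1(0)$ for all $t\ge0$. **Corollary.** Let $0<m\le1$. 1. For every initial datum $c_0$ with $\int_0^\infty s\,c_0(s)\,ds=m$ there is at most one mass-conserving solution with $c(\cdot,0)=c_0$: if $c$ and $d$ are two of them, then for every $t\ge0$, $c(s,t)=d(s,t)$ for a.e. $s>0$. 2. For every positive Radon measure $\mu_0$ on $(0,\infty)$ with $\int_0^\infty s\,\mu_0(ds)=m$ there is at most one mass-conserving weak solution in the measure sense with initial value $\mu_0$: if $(\mu_t)$ and $(\nu_t)$ are two of them, then $\mu_t=\nu_t$ for every $t\ge0$. -/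

import Mathlib

open Set MeasureTheory

namespace CoagFrag

/-- Admissible test functions: `φ ∈ BC([0,∞)) ∩ Lip([0,∞))` with `φ(0) = 0`.
Only the values of `φ` on `[0,∞)` matter. -/
structure IsTestFunction (φ : ℝ → ℝ) : Prop where
  continuousOn : ContinuousOn φ (Ici 0)
  bounded : ∃ B : ℝ, ∀ s ∈ Ici (0 : ℝ), |φ s| ≤ B
  lipschitz : ∃ K : NNReal, LipschitzOnWith K φ (Ici 0)
  map_zero : φ 0 = 0

/-! Densities `c s t`: size `s > 0`, time `t ≥ 0`. -/

/-- The total mass `m₁(t) = ∫₀^∞ s c(s,t) ds`, as an element of `[0,∞]`. -/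
noncomputable def mass (c : ℝ → ℝ → ℝ) (t : ℝ) : ENNReal :=
  ∫⁻ s in Ioi (0 : ℝ), ENNReal.ofReal (s * c s t)

/-- The right-hand side of the weak coagulation-fragmentation equation with kernels
`a(s,r) = s * r` and `b(s,r) = 1`, tested against `φ`, at time `t`. -/
noncomputable def weakRHS (c : ℝ → ℝ → ℝ) (φ : ℝ → ℝ) (t : ℝ) : ℝ :=
  (1 / 2) * (∫ s in Ioi (0 : ℝ), ∫ r in Ioi (0 : ℝ),
      (φ (s + r) - φ s - φ r) * (s * c s t) * (r * c r t))
    - (1 / 2) * (∫ s in Ioi (0 : ℝ), (∫ r in (0 : ℝ)..s, (φ s - φ r - φ (s - r))) * c s t)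

/-- `c` is a (weak) solution, with finite mass at every time, of the
coagulation-fragmentation equation on the time interval `[0,∞)`. The time derivative is taken
at positive times, and the initial value is attained continuously. -/
structure IsSolution (c : ℝ → ℝ → ℝ) : Prop where
  aemeasurable : ∀ t, 0 ≤ t → AEMeasurable (fun s => c s t) (volume.restrict (Ioi 0))
  nonneg : ∀ t, 0 ≤ t → ∀ᵐ s ∂(volume.restrict (Ioi (0 : ℝ))), 0 ≤ c s t
  mass_ne_top : ∀ t, 0 ≤ t → mass c t ≠ ⊤
  hasDerivAt : ∀ φ, IsTestFunction φ → ∀ t, 0 < t →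
    HasDerivAt (fun τ => ∫ s in Ioi (0 : ℝ), φ s * c s τ) (weakRHS c φ t) t
  continuous_at_zero : ∀ φ, IsTestFunction φ →
    ContinuousWithinAt (fun τ => ∫ s in Ioi (0 : ℝ), φ s * c s τ) (Ici 0) 0

/-- A solution whose mass stays equal to its initial mass. -/
structure IsMassConservingSolution (c : ℝ → ℝ → ℝ) : Prop extends IsSolution c where
  mass_eq : ∀ t, 0 ≤ t → mass c t = mass c 0

/-! Families `μ t`, `t ≥ 0`, of positive Radon measures on `(0,∞)`, regarded as Borel
measures on the line that are concentrated on `(0,∞)`. -/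

/-- The total mass `∫ s μ_t(ds)`, as an element of `[0,∞]`. -/
noncomputable def measureMass (μ : ℝ → Measure ℝ) (t : ℝ) : ENNReal :=
  ∫⁻ s in Ioi (0 : ℝ), ENNReal.ofReal s ∂(μ t)

/-- The right-hand side of the weak coagulation-fragmentation equation with kernels
`a(s,r) = s * r` and `b(s,r) = 1`, for a family of measures. -/
noncomputable def measureWeakRHS (μ : ℝ → Measure ℝ) (φ : ℝ → ℝ) (t : ℝ) : ℝ :=
  (1 / 2) * (∫ s in Ioi (0 : ℝ), ∫ r in Ioi (0 : ℝ),
      (φ (s + r) - φ s - φ r) * (s * r) ∂(μ t) ∂(μ t))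
    - (1 / 2) * (∫ s in Ioi (0 : ℝ), (∫ r in (0 : ℝ)..s, (φ s - φ r - φ (s - r))) ∂(μ t))

/-- `μ` is a weak solution in the measure sense, with finite mass at every time, of the
coagulation-fragmentation equation on the time interval `[0,∞)`. (On `(0,∞)`, a Borel measure
that is finite on compact sets is a Radon measure.) -/
structure IsMeasureSolution (μ : ℝ → Measure ℝ) : Prop where
  concentrated : ∀ t, 0 ≤ t → μ t (Iic 0) = 0
  finite_on_compacts : ∀ t, 0 ≤ t → ∀ K ⊆ Ioi (0 : ℝ), IsCompact K → μ t K ≠ ⊤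
  mass_ne_top : ∀ t, 0 ≤ t → measureMass μ t ≠ ⊤
  hasDerivAt : ∀ φ, IsTestFunction φ → ∀ t, 0 < t →
    HasDerivAt (fun τ => ∫ s in Ioi (0 : ℝ), φ s ∂(μ τ)) (measureWeakRHS μ φ t) t
  continuous_at_zero : ∀ φ, IsTestFunction φ →
    ContinuousWithinAt (fun τ => ∫ s in Ioi (0 : ℝ), φ s ∂(μ τ)) (Ici 0) 0

/-- A measure-valued weak solution whose mass stays equal to its initial mass. -/
structure IsMassConservingMeasureSolution (μ : ℝ → Measure ℝ) : Prop
    extends IsMeasureSolution μ where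
  mass_eq : ∀ t, 0 ≤ t → measureMass μ t = measureMass μ 0

end CoagFrag

open Filter Topology

namespace CoagFrag

lemma nonneg_of_hasDerivAt_of_forall_le_left {f : ℝ → ℝ} {f' a t : ℝ} (hat : a < t)
    (hf : HasDerivAt f f' t) (hmax : ∀ s ∈ Ioo a t, f s ≤ f t) : 0 ≤ f' := by
  have h := (hasDerivWithinAt_iff_tendsto_slope' (s := Iio t) (by simp)).1
    hf.hasDerivWithinAt
  refine ge_of_tendsto h ?_
  filter_upwards [Ioo_mem_nhdsLT hat] with s hs
  rw [slope_def_field]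
  exact div_nonneg_of_nonpos (by linarith [hmax s hs]) (by linarith [hs.2])

/-- A maximum principle on the half-line for `w_t + b w_x + w / x = 0` with `b ≥ -B`. -/
lemma transport_nonpos {w wx b : ℝ → ℝ → ℝ} {M B : ℝ} (hM : 0 < M) (hB : 0 ≤ B)
    (hbound : ∀ x t, 0 < x → 0 ≤ t → w x t ≤ M * x)
    (hlip : ∀ x y t, 0 < x → 0 < y → 0 ≤ t → |w x t - w y t| ≤ M * |x - y|)
    (hcont : ∀ x, 0 < x → ContinuousOn (w x) (Ici 0))
    (hx : ∀ x t, 0 < x → 0 ≤ t → HasDerivAt (fun y => w y t) (wx x t) x)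
    (ht : ∀ x t, 0 < x → 0 < t → HasDerivAt (w x) (-(b x t * wx x t) - w x t / x) t)
    (hb : ∀ x t, 0 < x → 0 < t → -B ≤ b x t)
    (h0 : ∀ x, 0 < x → w x 0 = 0) {x t : ℝ} (hx0 : 0 < x) (ht0 : 0 ≤ t) :
    w x t ≤ 0 := by
  by_contra! hpos
  set K : ℝ := 2 * B + 1 with hK
  obtain ⟨δ, hδ, hδw⟩ : ∃ δ > 0, δ * (Real.exp (K * t) * (1 + x ^ 2)) < w x t := by
    have hc : 0 < Real.exp (K * t) * (1 + x ^ 2) := by positivity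
    refine ⟨w x t / (2 * (Real.exp (K * t) * (1 + x ^ 2))), by positivity, ?_⟩
    have : w x t / (2 * (Real.exp (K * t) * (1 + x ^ 2))) * (Real.exp (K * t) * (1 + x ^ 2))
      = w x t / 2 := by field_simp
    linarith
  set ψ : ℝ × ℝ → ℝ := fun p => w p.1 p.2 - δ * (Real.exp (K * p.2) * (1 + p.1 ^ 2)) with hψ
  have hψ_le : ∀ y s, 0 < y → 0 ≤ s → ψ (y, s) ≤ M * y - δ * (1 + y ^ 2) := by
    intro y s hy hs
    have h1 : 1 ≤ Real.exp (K * s) := Real.one_le_exp (by positivity)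
    have h2 : δ * (1 + y ^ 2) ≤ δ * (Real.exp (K * s) * (1 + y ^ 2)) := by
      gcongr
      nlinarith [sq_nonneg y]
    have := hbound y s hy hs
    simp only [hψ]
    linarith
  set r := min (δ / M) x
  set R := max (M / δ) x
  have hr : 0 < r := lt_min (by positivity) hx0
  have hψ_edge : ∀ y s, 0 < y → 0 ≤ s → y ≤ δ / M ∨ M / δ ≤ y → ψ (y, s) ≤ 0 := by
    intro y s hy hs h
    refine (hψ_le y s hy hs).trans ?_
    rcases h with h | h
    · rw [le_div_iff₀ hM] at h
      nlinarith [mul_nonneg hδ.le (sq_nonneg y)]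
    · rw [div_le_iff₀ hδ] at h
      nlinarith
  have hψ_cont : ContinuousOn ψ (Icc r R ×ˢ Icc 0 t) := by
    refine ContinuousOn.sub ?_ (by fun_prop)
    rintro ⟨y, s⟩ ⟨hy, hs⟩
    have hy0 : 0 < y := hr.trans_le hy.1
    have hws : ContinuousWithinAt (fun p : ℝ × ℝ => w y p.2) (Icc r R ×ˢ Icc 0 t) (y, s) :=
      ((hcont y hy0).continuousWithinAt hs.1).comp continuous_snd.continuousWithinAt
        (fun p hp => hp.2.1)
    have hd : Tendsto (fun p : ℝ × ℝ => w p.1 p.2 - w y p.2)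
        (𝓝[Icc r R ×ˢ Icc 0 t] (y, s)) (𝓝 0) := by
      refine squeeze_zero_norm' (a := fun p => M * |p.1 - y|) ?_ ?_
      · filter_upwards [self_mem_nhdsWithin] with p hp
        exact hlip _ _ _ (hr.trans_le hp.1.1) hy0 hp.2.1
      · have : Continuous (fun p : ℝ × ℝ => M * |p.1 - y|) := by fun_prop
        simpa using (this.tendsto (y, s)).mono_left nhdsWithin_le_nhds
    have := hd.add hws.tendsto
    simpa [ContinuousWithinAt] using this
  obtain ⟨⟨y, s⟩, ⟨hy, hs⟩, hmax⟩ := (isCompact_Icc.prod isCompact_Icc).exists_isMaxOn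
    ⟨(x, t), ⟨⟨min_le_right _ _, le_max_right _ _⟩, ht0, le_rfl⟩⟩ hψ_cont
  have hmax' : ∀ p ∈ Icc r R ×ˢ Icc 0 t, ψ p ≤ ψ (y, s) := hmax
  have hψ_pos : 0 < ψ (y, s) := by
    refine lt_of_lt_of_le ?_ (hmax' (x, t) ⟨⟨min_le_right _ _, le_max_right _ _⟩, ht0, le_rfl⟩)
    simp only [hψ]
    linarith
  have hy0 : 0 < y := hr.trans_le hy.1
  have hy_left : δ / M < y := by
    by_contra! h
    exact absurd (hψ_edge y s hy0 hs.1 (.inl h)) (not_le.2 hψ_pos)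
  have hy_right : y < M / δ := by
    by_contra! h
    exact absurd (hψ_edge y s hy0 hs.1 (.inr h)) (not_le.2 hψ_pos)
  have hs0 : 0 < s := by
    rcases hs.1.eq_or_lt with h | h
    · subst h
      have : 0 < δ * (Real.exp (K * 0) * (1 + y ^ 2)) := by positivity
      simp only [hψ, h0 y hy0] at hψ_pos
      linarith
    · exact h
  have hdx : HasDerivAt (fun z => ψ (z, s))
      (wx y s - δ * (Real.exp (K * s) * (2 * y))) y := by
    have h1 : HasDerivAt (fun z : ℝ => δ * (Real.exp (K * s) * (1 + z ^ 2)))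
        (δ * (Real.exp (K * s) * (2 * y))) y := by
      simpa using (((hasDerivAt_pow 2 y).const_add 1).const_mul (Real.exp (K * s))).const_mul δ
    exact (hx y s hy0 hs.1).sub h1
  have hdt : HasDerivAt (fun τ => ψ (y, τ)) (-(b y s * wx y s) - w y s / y
      - δ * (Real.exp (K * s) * K * (1 + y ^ 2))) s := by
    have h1 : HasDerivAt (fun τ : ℝ => δ * (Real.exp (K * τ) * (1 + y ^ 2)))
        (δ * (Real.exp (K * s) * K * (1 + y ^ 2))) s := by
      have := ((hasDerivAt_id s).const_mul K).exp
      simpa using (this.mul_const (1 + y ^ 2)).const_mul δ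
    exact (ht y s hy0 hs0).sub h1
  have hloc : IsLocalMax (fun z => ψ (z, s)) y := by
    filter_upwards [Ioo_mem_nhds hy_left hy_right] with z hz
    exact hmax' (z, s) ⟨⟨(min_le_left _ _).trans hz.1.le, hz.2.le.trans (le_max_left _ _)⟩, hs⟩
  have hwx := hloc.hasDerivAt_eq_zero hdx
  have hwt := nonneg_of_hasDerivAt_of_forall_le_left hs0 hdt
    (fun τ hτ => hmax' (y, τ) ⟨hy, hτ.1.le, hτ.2.le.trans hs.2⟩)
  set E := δ * Real.exp (K * s) with hE
  have hEpos : 0 < E := by positivity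
  have hw_pos : 0 < w y s / y := by
    have : 0 < δ * (Real.exp (K * s) * (1 + y ^ 2)) := by positivity
    simp only [hψ] at hψ_pos
    exact div_pos (by linarith) hy0
  have e1 : wx y s = E * (2 * y) := by rw [hE]; linarith
  have h3 : -(b y s) * (2 * y) ≤ K * (1 + y ^ 2) := by
    have := hb y s hy0 hs0
    nlinarith [sq_nonneg (y - 1)]
  have h4 := mul_le_mul_of_nonneg_left h3 hEpos.le
  have h5 : δ * (Real.exp (K * s) * K * (1 + y ^ 2)) = E * (K * (1 + y ^ 2)) := by
    rw [hE]; ring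
  rw [h5, e1] at hwt
  nlinarith

/-- The Bernstein transform of the part of a measure on `(0,∞)`. -/
noncomputable def bernstein (μ : Measure ℝ) (x : ℝ) : ℝ :=
  ∫ s in Ioi (0 : ℝ), (1 - Real.exp (-(x * s))) ∂μ

/-- The derivative of the Bernstein transform. -/
noncomputable def bernsteinDeriv (μ : Measure ℝ) (x : ℝ) : ℝ :=
  ∫ s in Ioi (0 : ℝ), s * Real.exp (-(x * s)) ∂μ

lemma abs_exp_neg_sub_exp_neg_le {a b : ℝ} (ha : 0 ≤ a) (hb : 0 ≤ b) :
    |Real.exp (-a) - Real.exp (-b)| ≤ |a - b| := by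
  wlog hab : a ≤ b generalizing a b
  · rw [abs_sub_comm, abs_sub_comm a]
    exact this hb ha (le_of_not_ge hab)
  have h1 : Real.exp (-b) ≤ Real.exp (-a) := Real.exp_le_exp.2 (by linarith)
  rw [abs_of_nonneg (by linarith), abs_of_nonpos (by linarith)]
  have h2 : Real.exp (-b) = Real.exp (-a) * Real.exp (-(b - a)) := by
    rw [← Real.exp_add]; ring_nf
  have h3 := Real.one_sub_le_exp_neg (b - a)
  have h4 : Real.exp (-a) ≤ 1 := Real.exp_le_one_iff.2 (by linarith)
  have h5 := Real.exp_pos (-a)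
  rw [h2]
  nlinarith

lemma isTestFunction_one_sub_exp {x : ℝ} (hx : 0 ≤ x) :
    IsTestFunction (fun s => 1 - Real.exp (-(x * s))) where
  continuousOn := by fun_prop
  bounded := by
    refine ⟨1, fun s hs => ?_⟩
    have h1 : Real.exp (-(x * s)) ≤ 1 :=
      Real.exp_le_one_iff.2 (by have := mul_nonneg hx (mem_Ici.1 hs); linarith)
    have h2 := Real.exp_pos (-(x * s))
    rw [abs_le]
    constructor <;> linarith
  lipschitz := by
    refine ⟨⟨x, hx⟩, LipschitzOnWith.of_dist_le_mul fun s hs r hr => ?_⟩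
    rw [Real.dist_eq, Real.dist_eq]
    have h := abs_exp_neg_sub_exp_neg_le (mul_nonneg hx (mem_Ici.1 hs))
      (mul_nonneg hx (mem_Ici.1 hr))
    rw [← mul_sub, abs_mul, abs_of_nonneg hx] at h
    rw [sub_sub_sub_cancel_left, abs_sub_comm]
    exact h
  map_zero := by simp

variable {μ : Measure ℝ}

lemma integrableOn_one_sub_exp (h : IntegrableOn (fun s => s) (Ioi 0) μ) {x : ℝ} (hx : 0 ≤ x) :
    IntegrableOn (fun s => 1 - Real.exp (-(x * s))) (Ioi 0) μ := by
  refine (h.const_mul x).mono' (by fun_prop) ?_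
  filter_upwards [ae_restrict_mem measurableSet_Ioi] with s hs
  have hxs : 0 ≤ x * s := mul_nonneg hx (mem_Ioi.1 hs).le
  have := abs_exp_neg_sub_exp_neg_le le_rfl hxs
  simpa [abs_of_nonneg hx, abs_of_pos (mem_Ioi.1 hs)] using this

lemma integrableOn_mul_exp (h : IntegrableOn (fun s => s) (Ioi 0) μ) {x : ℝ} (hx : 0 ≤ x) :
    IntegrableOn (fun s => s * Real.exp (-(x * s))) (Ioi 0) μ := by
  refine h.mono' (by fun_prop) ?_
  filter_upwards [ae_restrict_mem measurableSet_Ioi] with s hs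
  have hs := mem_Ioi.1 hs
  rw [Real.norm_eq_abs, abs_mul, abs_of_pos hs, Real.abs_exp]
  have : Real.exp (-(x * s)) ≤ 1 := Real.exp_le_one_iff.2 (by nlinarith)
  nlinarith

lemma bernstein_nonneg {x : ℝ} (hx : 0 ≤ x) : 0 ≤ bernstein μ x := by
  refine setIntegral_nonneg measurableSet_Ioi fun s hs => ?_
  have : Real.exp (-(x * s)) ≤ 1 := Real.exp_le_one_iff.2 (by nlinarith [mem_Ioi.1 hs])
  linarith

lemma abs_bernstein_sub_le (h : IntegrableOn (fun s => s) (Ioi 0) μ) {x y : ℝ} (hx : 0 ≤ x)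
    (hy : 0 ≤ y) :
    |bernstein μ x - bernstein μ y| ≤ (∫ s in Ioi (0 : ℝ), s ∂μ) * |x - y| := by
  rw [bernstein, bernstein, ← integral_sub (integrableOn_one_sub_exp h hx)
    (integrableOn_one_sub_exp h hy), ← integral_mul_const, ← Real.norm_eq_abs]
  refine norm_integral_le_of_norm_le (h.mul_const _) ?_
  filter_upwards [ae_restrict_mem measurableSet_Ioi] with s hs
  have hs := mem_Ioi.1 hs
  have := abs_exp_neg_sub_exp_neg_le (mul_nonneg hy hs.le) (mul_nonneg hx hs.le)
  rw [← sub_mul, abs_mul, abs_of_pos hs, abs_sub_comm y] at this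
  rw [Real.norm_eq_abs, sub_sub_sub_cancel_left]
  linarith

lemma bernstein_le (h : IntegrableOn (fun s => s) (Ioi 0) μ) {x : ℝ} (hx : 0 ≤ x) :
    bernstein μ x ≤ (∫ s in Ioi (0 : ℝ), s ∂μ) * x := by
  have h1 := abs_bernstein_sub_le h hx le_rfl
  have h2 : bernstein μ 0 = 0 := by simp [bernstein]
  rw [h2, sub_zero, sub_zero, abs_of_nonneg hx] at h1
  exact (le_abs_self _).trans h1

lemma bernsteinDeriv_nonneg (μ : Measure ℝ) (x : ℝ) : 0 ≤ bernsteinDeriv μ x :=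
  setIntegral_nonneg measurableSet_Ioi fun s hs => by
    have := mem_Ioi.1 hs
    positivity

lemma hasDerivAt_bernstein (h : IntegrableOn (fun s => s) (Ioi 0) μ) {x : ℝ} (hx : 0 < x) :
    HasDerivAt (bernstein μ) (bernsteinDeriv μ x) x := by
  refine (hasDerivAt_integral_of_dominated_loc_of_deriv_le (s := Ioi 0) (bound := fun s => s)
    (F := fun x s => 1 - Real.exp (-(x * s))) (F' := fun x s => s * Real.exp (-(x * s)))
    (Ioi_mem_nhds hx) (Eventually.of_forall fun y => by fun_prop)
    (integrableOn_one_sub_exp h hx.le) (by fun_prop) ?_ h ?_).2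
  · filter_upwards [ae_restrict_mem measurableSet_Ioi] with s hs y hy
    have hs := mem_Ioi.1 hs
    have hy := mem_Ioi.1 hy
    rw [Real.norm_eq_abs, abs_mul, abs_of_pos hs, Real.abs_exp]
    have : Real.exp (-(y * s)) ≤ 1 := Real.exp_le_one_iff.2 (by nlinarith)
    nlinarith
  · refine Eventually.of_forall fun s y _ => ?_
    have h1 : HasDerivAt (fun z : ℝ => -(z * s)) (-s) y := by
      simpa using ((hasDerivAt_id y).mul_const s).fun_neg
    convert! h1.exp.const_sub 1 using 1
    ring

lemma integral_fragmentation_one_sub_exp {x : ℝ} (hx : x ≠ 0) (s : ℝ) :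
    ∫ r in (0 : ℝ)..s, ((1 - Real.exp (-(x * s))) - (1 - Real.exp (-(x * r)))
      - (1 - Real.exp (-(x * (s - r)))))
      = 2 / x * (1 - Real.exp (-(x * s))) - s - s * Real.exp (-(x * s)) := by
  have hd : ∀ r ∈ uIcc 0 s, HasDerivAt (fun r => (-1 - Real.exp (-(x * s))) * r
      - Real.exp (-(x * r)) / x + Real.exp (-(x * (s - r))) / x)
      ((1 - Real.exp (-(x * s))) - (1 - Real.exp (-(x * r)))
      - (1 - Real.exp (-(x * (s - r))))) r := by
    intro r _
    have h1 : HasDerivAt (fun r : ℝ => -(x * r)) (-x) r := by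
      simpa using ((hasDerivAt_id r).const_mul x).fun_neg
    have h2 : HasDerivAt (fun r : ℝ => -(x * (s - r))) x r := by
      simpa using (((hasDerivAt_id r).const_sub s).const_mul x).fun_neg
    convert! (((hasDerivAt_id r).const_mul (-1 - Real.exp (-(x * s)))).sub
      (h1.exp.div_const x)).add (h2.exp.div_const x) using 1
    field_simp
    ring
  rw [intervalIntegral.integral_eq_sub_of_hasDerivAt hd
    (Continuous.intervalIntegrable (by fun_prop) _ _)]
  simp
  field_simp
  ring

lemma measureWeakRHS_one_sub_exp {μ : ℝ → Measure ℝ} {t x : ℝ}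
    (h : IntegrableOn (fun s => s) (Ioi 0) (μ t)) (hx : 0 < x) :
    measureWeakRHS μ (fun s => 1 - Real.exp (-(x * s))) t
      = -(1 / 2) * ((∫ s in Ioi (0 : ℝ), s ∂(μ t)) - bernsteinDeriv (μ t) x) ^ 2
        + (1 / 2) * ((∫ s in Ioi (0 : ℝ), s ∂(μ t)) + bernsteinDeriv (μ t) x)
        - bernstein (μ t) x / x := by
  have hI : ∫ r in Ioi (0 : ℝ), (r - r * Real.exp (-(x * r))) ∂(μ t)
      = (∫ s in Ioi (0 : ℝ), s ∂(μ t)) - bernsteinDeriv (μ t) x :=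
    integral_sub h (integrableOn_mul_exp h hx.le)
  have hcoag : ∀ s r : ℝ, ((1 - Real.exp (-(x * (s + r)))) - (1 - Real.exp (-(x * s)))
      - (1 - Real.exp (-(x * r)))) * (s * r)
      = -(s - s * Real.exp (-(x * s))) * (r - r * Real.exp (-(x * r))) := by
    intro s r
    rw [mul_add, neg_add, Real.exp_add]
    ring
  have hfrag : ∫ s in Ioi (0 : ℝ), (2 / x * (1 - Real.exp (-(x * s))) - s
      - s * Real.exp (-(x * s))) ∂(μ t)
      = 2 / x * bernstein (μ t) x - (∫ s in Ioi (0 : ℝ), s ∂(μ t)) - bernsteinDeriv (μ t) x := by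
    have h1 := (integrableOn_one_sub_exp h hx.le).const_mul (2 / x)
    have h2 : Integrable (fun s => 2 / x * (1 - Real.exp (-(x * s))) - s)
      ((μ t).restrict (Ioi 0)) := h1.sub h
    rw [integral_sub h2 (integrableOn_mul_exp h hx.le), integral_sub h1 h, integral_const_mul]
    rfl
  simp only [measureWeakRHS, hcoag, integral_const_mul, integral_mul_const, integral_neg, hI,
    integral_fragmentation_one_sub_exp hx.ne', hfrag]
  field_simp
  ring

/-- The measure `s e^{-s} μ(ds)` on `(0,∞)`, which is finite with some exponential moments whenever
`μ` has finite mass. -/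
noncomputable def tilted (μ : Measure ℝ) : Measure ℝ :=
  (μ.restrict (Ioi 0)).withDensity (fun s => ENNReal.ofReal (s * Real.exp (-s)))

lemma integrable_tilted_iff {μ : Measure ℝ} {t : ℝ} :
    Integrable (fun s => Real.exp (t * s)) (tilted μ) ↔
      IntegrableOn (fun s => s * Real.exp (-((1 - t) * s))) (Ioi 0) μ := by
  rw [tilted, integrable_withDensity_iff_integrable_smul' (by fun_prop) (by simp)]
  refine integrable_congr ?_
  filter_upwards [ae_restrict_mem measurableSet_Ioi] with s hs
  have hs := mem_Ioi.1 hs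
  rw [ENNReal.toReal_ofReal (by positivity), smul_eq_mul, mul_assoc, ← Real.exp_add]
  ring_nf

lemma mgf_tilted (μ : Measure ℝ) (t : ℝ) :
    ProbabilityTheory.mgf id (tilted μ) t = bernsteinDeriv μ (1 - t) := by
  rw [ProbabilityTheory.mgf, tilted, integral_withDensity_eq_integral_toReal_smul (by fun_prop)
    (by simp), bernsteinDeriv]
  refine integral_congr_ae ?_
  filter_upwards [ae_restrict_mem measurableSet_Ioi] with s hs
  have hs := mem_Ioi.1 hs
  rw [ENNReal.toReal_ofReal (by positivity), smul_eq_mul, mul_assoc, ← Real.exp_add]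
  simp only [id]
  ring_nf

lemma eq_of_tilted_eq {μ ν : Measure ℝ} (hμ : μ (Iic 0) = 0) (hν : ν (Iic 0) = 0)
    (h : tilted μ = tilted ν) : μ = ν := by
  have key : ∀ ρ : Measure ℝ, ρ (Iic 0) = 0 → (tilted ρ).withDensity
      (fun s => (ENNReal.ofReal (s * Real.exp (-s)))⁻¹) = ρ := by
    intro ρ hρ
    rw [tilted, withDensity_inv_same (by fun_prop) _ (by simp)]
    · refine Measure.restrict_eq_self_of_ae_mem ?_
      rw [ae_iff]
      convert hρ using 2
      ext s
      simp
    · filter_upwards [ae_restrict_mem measurableSet_Ioi] with s hs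
      have hs := mem_Ioi.1 hs
      have : 0 < s * Real.exp (-s) := by positivity
      simpa using this
  rw [← key μ hμ, ← key ν hν, h]

/-- The Bernstein transform determines a measure on `(0,∞)` with finite mass. -/
lemma eq_of_bernstein_eq {μ ν : Measure ℝ} (hμ : μ (Iic 0) = 0) (hν : ν (Iic 0) = 0)
    (hμi : IntegrableOn (fun s => s) (Ioi 0) μ) (hνi : IntegrableOn (fun s => s) (Ioi 0) ν)
    (h : ∀ x, 0 < x → bernstein μ x = bernstein ν x) : μ = ν := by
  refine eq_of_tilted_eq hμ hν ?_
  have hsub : ∀ ρ : Measure ℝ, IntegrableOn (fun s => s) (Ioi 0) ρ →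
      Iio 1 ⊆ interior (ProbabilityTheory.integrableExpSet id (tilted ρ)) := by
    intro ρ hρ
    refine interior_maximal (fun t ht => ?_) isOpen_Iio
    exact integrable_tilted_iff.2 (integrableOn_mul_exp hρ (by linarith [mem_Iio.1 ht]))
  have hfin : ∀ ρ : Measure ℝ, IntegrableOn (fun s => s) (Ioi 0) ρ →
      IsFiniteMeasure (tilted ρ) := by
    intro ρ hρ
    have h0 := (integrable_tilted_iff (t := 0)).2
      (integrableOn_mul_exp hρ (by norm_num : (0 : ℝ) ≤ 1 - 0))
    simpa [integrable_const_iff, isFiniteMeasure_iff] using h0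
  have := hfin μ hμi
  have := hfin ν hνi
  have han : ∀ ρ : Measure ℝ, IntegrableOn (fun s => s) (Ioi 0) ρ →
      AnalyticOnNhd ℂ (ProbabilityTheory.complexMGF id (tilted ρ)) {z | z.re ∈ Iio (1 : ℝ)} :=
    fun ρ hρ => ProbabilityTheory.analyticOnNhd_complexMGF.mono fun z hz => hsub ρ hρ hz
  have hmgf : ∀ t < 1, ProbabilityTheory.mgf id (tilted μ) t
      = ProbabilityTheory.mgf id (tilted ν) t := by
    intro t ht
    rw [mgf_tilted, mgf_tilted]
    have ht : 0 < 1 - t := by linarith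
    refine (hasDerivAt_bernstein hμi ht).unique
      ((hasDerivAt_bernstein hνi ht).congr_of_eventuallyEq ?_)
    filter_upwards [Ioi_mem_nhds ht] with x hx using h x hx
  have heq : EqOn (ProbabilityTheory.complexMGF id (tilted μ))
      (ProbabilityTheory.complexMGF id (tilted ν)) {z | z.re ∈ Iio (1 : ℝ)} := by
    refine (han μ hμi).eqOn_of_preconnected_of_frequently_eq (han ν hνi)
      ((convex_Iio (1 : ℝ)).linear_preimage Complex.reLm).isPreconnected (z₀ := 0) (by simp) ?_
    have hlim : Tendsto (fun t : ℝ => (t : ℂ)) (𝓝[<] 0) (𝓝[≠] 0) := by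
      refine tendsto_nhdsWithin_iff.2 ⟨?_, ?_⟩
      · exact (Complex.continuous_ofReal.tendsto' 0 0 (by simp)).mono_left nhdsWithin_le_nhds
      · filter_upwards [self_mem_nhdsWithin] with t ht
        simpa using (mem_Iio.1 ht).ne
    refine hlim.frequently (Eventually.frequently ?_)
    filter_upwards [self_mem_nhdsWithin] with t ht
    rw [ProbabilityTheory.complexMGF_ofReal, ProbabilityTheory.complexMGF_ofReal,
      hmgf t ((mem_Iio.1 ht).trans one_pos)]
  refine Measure.ext_of_charFun (funext fun t => ?_)
  rw [← ProbabilityTheory.complexMGF_id_mul_I, ← ProbabilityTheory.complexMGF_id_mul_I]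
  exact heq (by simp)

lemma IsMeasureSolution.integrableOn {μ : ℝ → Measure ℝ} (h : IsMeasureSolution μ) {t : ℝ}
    (ht : 0 ≤ t) : IntegrableOn (fun s => s) (Ioi 0) (μ t) := by
  refine ⟨by fun_prop, ?_⟩
  rw [hasFiniteIntegral_iff_ofReal]
  · exact lt_top_iff_ne_top.2 (h.mass_ne_top t ht)
  · filter_upwards [ae_restrict_mem measurableSet_Ioi] with s hs using (mem_Ioi.1 hs).le

lemma integral_eq_toReal_measureMass (μ : ℝ → Measure ℝ) (t : ℝ) :
    ∫ s in Ioi (0 : ℝ), s ∂(μ t) = (measureMass μ t).toReal := by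
  refine integral_eq_lintegral_of_nonneg_ae ?_ (by fun_prop)
  filter_upwards [ae_restrict_mem measurableSet_Ioi] with s hs using (mem_Ioi.1 hs).le

lemma IsMassConservingMeasureSolution.integral_eq {μ : ℝ → Measure ℝ}
    (h : IsMassConservingMeasureSolution μ) {t : ℝ} (ht : 0 ≤ t) :
    ∫ s in Ioi (0 : ℝ), s ∂(μ t) = ∫ s in Ioi (0 : ℝ), s ∂(μ 0) := by
  rw [integral_eq_toReal_measureMass, integral_eq_toReal_measureMass, h.mass_eq t ht]

lemma IsMeasureSolution.continuousOn_bernstein {μ : ℝ → Measure ℝ} (h : IsMeasureSolution μ)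
    {x : ℝ} (hx : 0 ≤ x) : ContinuousOn (fun t => bernstein (μ t) x) (Ici 0) := by
  intro t ht
  rcases (mem_Ici.1 ht).eq_or_lt with rfl | ht
  · exact h.continuous_at_zero _ (isTestFunction_one_sub_exp hx)
  · exact (h.hasDerivAt _ (isTestFunction_one_sub_exp hx) t
      ht).continuousAt.continuousWithinAt

/-- The Bernstein transforms of two mass-conserving solutions with the same initial value are
ordered. -/
lemma IsMassConservingMeasureSolution.bernstein_le_bernstein {μ ν : ℝ → Measure ℝ}
    (hμ : IsMassConservingMeasureSolution μ) (hν : IsMassConservingMeasureSolution ν)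
    (h0 : μ 0 = ν 0) {x t : ℝ} (hx : 0 < x) (ht : 0 ≤ t) :
    bernstein (μ t) x ≤ bernstein (ν t) x := by
  set m := ∫ s in Ioi (0 : ℝ), s ∂(μ 0) with hm
  have hm0 : 0 ≤ m := setIntegral_nonneg measurableSet_Ioi fun s hs => (mem_Ioi.1 hs).le
  have hμm : ∀ t, 0 ≤ t → ∫ s in Ioi (0 : ℝ), s ∂(μ t) = m := fun t ht => hμ.integral_eq ht
  have hνm : ∀ t, 0 ≤ t → ∫ s in Ioi (0 : ℝ), s ∂(ν t) = m := fun t ht => by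
    rw [hν.integral_eq ht, hm, h0]
  have hμi := fun t (ht : 0 ≤ t) => hμ.integrableOn ht
  have hνi := fun t (ht : 0 ≤ t) => hν.integrableOn ht
  have key := transport_nonpos (w := fun x t => bernstein (μ t) x - bernstein (ν t) x)
    (wx := fun x t => bernsteinDeriv (μ t) x - bernsteinDeriv (ν t) x)
    (b := fun x t => (bernsteinDeriv (μ t) x + bernsteinDeriv (ν t) x) / 2 - m - 1 / 2)
    (M := 2 * m + 1) (B := m + 1 / 2) (by linarith) (by linarith) ?_ ?_ ?_ ?_ ?_ ?_ ?_ hx ht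
  · simpa using key
  · intro x t hx ht
    have h1 := bernstein_le (hμi t ht) hx.le
    rw [hμm t ht] at h1
    have h2 := bernstein_nonneg (μ := ν t) hx.le
    nlinarith
  · intro x y t hx hy ht
    have h1 := abs_bernstein_sub_le (hμi t ht) hx.le hy.le
    have h2 := abs_bernstein_sub_le (hνi t ht) hx.le hy.le
    rw [hμm t ht] at h1
    rw [hνm t ht] at h2
    have h3 := abs_sub (bernstein (μ t) x - bernstein (μ t) y)
      (bernstein (ν t) x - bernstein (ν t) y)
    rw [sub_sub_sub_comm]
    nlinarith [abs_nonneg (x - y)]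
  · intro x hx
    exact (hμ.continuousOn_bernstein hx.le).sub (hν.continuousOn_bernstein hx.le)
  · intro x t hx ht
    exact (hasDerivAt_bernstein (hμi t ht) hx).sub (hasDerivAt_bernstein (hνi t ht) hx)
  · intro x t hx ht
    have h1 := hμ.hasDerivAt _ (isTestFunction_one_sub_exp hx.le) t ht
    have h2 := hν.hasDerivAt _ (isTestFunction_one_sub_exp hx.le) t ht
    rw [measureWeakRHS_one_sub_exp (hμi t ht.le) hx, hμm t ht.le] at h1
    rw [measureWeakRHS_one_sub_exp (hνi t ht.le) hx, hνm t ht.le] at h2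
    convert! h1.sub h2 using 1
    ring
  · intro x t hx ht
    have := bernsteinDeriv_nonneg (μ t) x
    have := bernsteinDeriv_nonneg (ν t) x
    linarith
  · intro x hx
    simp [h0]

theorem IsMassConservingMeasureSolution.unique {μ ν : ℝ → Measure ℝ}
    (hμ : IsMassConservingMeasureSolution μ) (hν : IsMassConservingMeasureSolution ν)
    (h0 : μ 0 = ν 0) {t : ℝ} (ht : 0 ≤ t) : μ t = ν t :=
  eq_of_bernstein_eq (hμ.concentrated t ht) (hν.concentrated t ht) (hμ.integrableOn ht)
    (hν.integrableOn ht) fun _ hx => le_antisymm (hμ.bernstein_le_bernstein hν h0 hx ht)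
      (hν.bernstein_le_bernstein hμ h0.symm hx ht)

/-- The measures `c(s,t) ds` on `(0,∞)`. -/
noncomputable def densityMeasure (c : ℝ → ℝ → ℝ) (t : ℝ) : Measure ℝ :=
  (volume.restrict (Ioi 0)).withDensity (fun s => ENNReal.ofReal (c s t))

variable {c : ℝ → ℝ → ℝ}

lemma densityMeasure_restrict (c : ℝ → ℝ → ℝ) (t : ℝ) :
    (densityMeasure c t).restrict (Ioi 0) = densityMeasure c t := by
  rw [densityMeasure, restrict_withDensity measurableSet_Ioi,
    Measure.restrict_restrict measurableSet_Ioi, inter_self]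

lemma IsSolution.setIntegral_densityMeasure (h : IsSolution c) {t : ℝ} (ht : 0 ≤ t)
    (g : ℝ → ℝ) :
    ∫ s in Ioi (0 : ℝ), g s ∂(densityMeasure c t) = ∫ s in Ioi (0 : ℝ), g s * c s t := by
  rw [densityMeasure_restrict, densityMeasure, integral_withDensity_eq_integral_toReal_smul₀
    (h.aemeasurable t ht).ennreal_ofReal (by simp)]
  refine integral_congr_ae ?_
  filter_upwards [h.nonneg t ht] with s hs
  rw [ENNReal.toReal_ofReal hs, smul_eq_mul, mul_comm]

lemma IsSolution.measureMass_densityMeasure (h : IsSolution c) {t : ℝ} (ht : 0 ≤ t) :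
    measureMass (densityMeasure c) t = mass c t := by
  rw [measureMass, densityMeasure_restrict, densityMeasure,
    lintegral_withDensity_eq_lintegral_mul₀ (h.aemeasurable t ht).ennreal_ofReal (by fun_prop)]
  refine lintegral_congr_ae ?_
  filter_upwards [ae_restrict_mem measurableSet_Ioi] with s hs
  rw [Pi.mul_apply, mul_comm, ENNReal.ofReal_mul (mem_Ioi.1 hs).le]

lemma IsSolution.measureWeakRHS_densityMeasure (h : IsSolution c) {t : ℝ} (ht : 0 ≤ t)
    (φ : ℝ → ℝ) : measureWeakRHS (densityMeasure c) φ t = weakRHS c φ t := by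
  simp only [measureWeakRHS, weakRHS, h.setIntegral_densityMeasure ht, ← integral_mul_const]
  congr 4 with s
  congr 1 with r
  ring

lemma IsSolution.isMeasureSolution (h : IsSolution c) : IsMeasureSolution (densityMeasure c) where
  concentrated t _ := by
    rw [← densityMeasure_restrict, Measure.restrict_apply measurableSet_Iic]
    simp [← compl_Ioi]
  finite_on_compacts t ht K hK hKc := by
    rcases K.eq_empty_or_nonempty with rfl | hne
    · simp
    obtain ⟨a, haK, ha⟩ := hKc.exists_isLeast hne
    have ha0 : 0 < a := hK haK
    have hle : ENNReal.ofReal a * densityMeasure c t K ≤ mass c t := by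
      rw [← h.measureMass_densityMeasure ht, measureMass, ← setLIntegral_const]
      refine (setLIntegral_mono (by fun_prop) fun s hs => ?_).trans (lintegral_mono_set hK)
      exact ENNReal.ofReal_le_ofReal (ha hs)
    intro htop
    rw [htop, ENNReal.mul_top (by simpa using ha0), top_le_iff] at hle
    exact h.mass_ne_top t ht hle
  mass_ne_top t ht := by
    rw [h.measureMass_densityMeasure ht]
    exact h.mass_ne_top t ht
  hasDerivAt φ hφ t ht := by
    rw [h.measureWeakRHS_densityMeasure ht.le]
    refine (h.hasDerivAt φ hφ t ht).congr_of_eventuallyEq ?_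
    filter_upwards [Ioi_mem_nhds ht] with τ hτ
    exact h.setIntegral_densityMeasure (mem_Ioi.1 hτ).le φ
  continuous_at_zero φ hφ :=
    (h.continuous_at_zero φ hφ).congr (fun τ hτ => h.setIntegral_densityMeasure hτ φ)
      (h.setIntegral_densityMeasure le_rfl φ)

lemma IsMassConservingSolution.isMassConservingMeasureSolution (h : IsMassConservingSolution c) :
    IsMassConservingMeasureSolution (densityMeasure c) where
  toIsMeasureSolution := h.isMeasureSolution
  mass_eq t ht := by
    rw [h.measureMass_densityMeasure ht, h.measureMass_densityMeasure le_rfl, h.mass_eq t ht]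

theorem IsMassConservingSolution.unique {c d : ℝ → ℝ → ℝ} (hc : IsMassConservingSolution c)
    (hd : IsMassConservingSolution d)
    (h0 : ∀ᵐ s ∂(volume.restrict (Ioi (0 : ℝ))), c s 0 = d s 0) {t : ℝ} (ht : 0 ≤ t) :
    ∀ᵐ s ∂(volume.restrict (Ioi (0 : ℝ))), c s t = d s t := by
  have h0' : densityMeasure c 0 = densityMeasure d 0 := by
    refine withDensity_congr_ae ?_
    filter_upwards [h0] with s hs
    rw [hs]
  have h := hc.isMassConservingMeasureSolution.unique hd.isMassConservingMeasureSolution h0' ht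
  have h' := (withDensity_eq_iff_of_sigmaFinite (hc.aemeasurable t ht).ennreal_ofReal
    (hd.aemeasurable t ht).ennreal_ofReal).1 h
  filter_upwards [h', hc.nonneg t ht, hd.nonneg t ht] with s hs h1 h2
  exact (ENNReal.ofReal_eq_ofReal_iff h1 h2).1 hs

end CoagFrag

theorem corollary1p2 (m : ℝ) (hm0 : 0 < m) (hm1 : m ≤ 1) :
    (∀ c d : ℝ → ℝ → ℝ,
      CoagFrag.IsMassConservingSolution c → CoagFrag.IsMassConservingSolution d →
      CoagFrag.mass c 0 = ENNReal.ofReal m →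
      (∀ᵐ s ∂(volume.restrict (Ioi (0 : ℝ))), c s 0 = d s 0) →
      ∀ t, 0 ≤ t → ∀ᵐ s ∂(volume.restrict (Ioi (0 : ℝ))), c s t = d s t) ∧
    (∀ μ ν : ℝ → Measure ℝ,
      CoagFrag.IsMassConservingMeasureSolution μ → CoagFrag.IsMassConservingMeasureSolution ν →
      CoagFrag.measureMass μ 0 = ENNReal.ofReal m →
      μ 0 = ν 0 →
      ∀ t, 0 ≤ t → μ t = ν t) := by
  exact ⟨fun _ _ hc hd _ h0 _ ht => hc.unique hd h0 ht,
    fun _ _ hμ hν _ h0 _ ht => hμ.unique hν h0 ht⟩
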